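/- All systems are finite-dimensional. For a Hermitian operator $X\neq 0$, a positive semi-definite operator $\sigma\neq 0$ and $\alpha\in[1,\infty)$ let $$\mu_\alpha(X\Vert\sigma)=\left\Vert \sigma^{\frac{1-\alpha}{2\alpha}}X\sigma^{\frac{1-\alpha}{2\alpha}}\right\Vert_\alpha\ \text{ if } \operatorname{supp}(X)\subseteq\operatorname{supp}(\sigma),\qquad \mu_\alpha(X\Vert\sigma)=+\infty\ \text{ otherwise},$$ where $\Vert Y\Vert_\alpha=(\operatorname{Tr}|Y|^\alpha)^{1/\alpha}$, $|Y|=\sqrt{Y^\dagger Y}$, and powers of $\sigma$ are taken on its support. For $\alpha=\infty$ let $\mu_\infty(X\Vert\sigma)=\Vert\sigma^{-1/2}X\sigma^{-1/2}\Vert_\infty$ (operator norm) if $\operatorname{supp}(X)\subseteq\operatorname{supp}(\sigma)$, and $+\infty$ otherwise. Let $T_B$ be the partial transpose on $B$ and $\operatorname{PPT}(A:B)=\{\sigma_{AB}:\sigma_{AB}\ge 0,\ T_B(\sigma_{AB})\ge 0,\ \operatorname{Tr}[\sigma_{AB}]=1\}$. The $\alpha$-logarithmic negativity of a bipartite state $\rho_{AB}$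 is $$E_N^\alpha(\rho_{A:B})=\inf_{\sigma_{AB}\in\operatorname{PPT}(A:B)}\log_2\mu_\alpha(T_B(\rho_{AB})\Vert\sigma_{AB}).$$ A function $E$ of bipartite states is called monogamous if $E(\rho_{A:B})+E(\rho_{A:C})\le E(\rho_{A:BC})$ for all tripartite states $\rho_{ABC}$, where $\rho_{AB}=\operatorname{Tr}_C\rho_{ABC}$ and $\rho_{AC}=\operatorname{Tr}_B\rho_{ABC}$. **Theorem.** For every $\alpha\in[1,\infty]$, $E_N^\alpha$ is not monogamous. Indeed, the vector $$|\psi\rangle_{ABC}=\tfrac12\left(|000\rangle_{ABC}+|011\rangle_{ABC}+\sqrt2\,|110\rangle_{ABC}\right)$$ defines a three-qubit state $\psi_{ABC}=|\psi\rangle\langle\psi|$, and for every $\alpha\in[1,\infty]$ $$E_N^\alpha(\psi_{A:B})+E_N^\alpha(\psi_{A:C})>E_N^\alpha(\psi_{A:BC}).$$ -/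

import Mathlib

open scoped ENNReal Matrix ComplexOrder

noncomputable section

namespace AlphaLogNeg

/-- `ρ` is a quantum state (density matrix). -/
def IsState {n : Type*} [Fintype n] (ρ : Matrix n n ℂ) : Prop :=
  ρ.PosSemidef ∧ ρ.trace = 1

/-- The partial transpose `T_B` on the second tensor factor. -/
def partialTranspose {a b : Type*} (Y : Matrix (a × b) (a × b) ℂ) :
    Matrix (a × b) (a × b) ℂ :=
  Matrix.of fun i j => Y (i.1, j.2) (j.1, i.2)

/-- The set `PPT(A:B)` of positive partial transpose states. -/
def PPT (a b : Type*) [Fintype a] [Fintype b] : Set (Matrix (a × b) (a × b) ℂ) :=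
  {σ | σ.PosSemidef ∧ (partialTranspose σ).PosSemidef ∧ σ.trace = 1}

/-- The absolute value `|Y| = √(Y† Y)`. -/
def matAbs {n : Type*} [Fintype n] [DecidableEq n] (Y : Matrix n n ℂ) : Matrix n n ℂ :=
  cfc Real.sqrt (Yᴴ * Y)

/-- The `α`-norm `(Tr |Y|^α)^(1/α)`; for `α = ∞` it is the operator norm on `ℂⁿ` with its
Euclidean norm. -/
def schattenNorm {n : Type*} [Fintype n] [DecidableEq n] (α : ℝ≥0∞) (Y : Matrix n n ℂ) : ℝ :=
  if α = ∞ then ‖Matrix.toEuclideanCLM (n := n) (𝕜 := ℂ) Y‖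
  else (cfc (fun x : ℝ => x ^ α.toReal) (matAbs Y)).trace.re ^ (1 / α.toReal)

/-- The real power `σ^s` of a positive semi-definite matrix in the generalized sense, that is,
taken on the support of `σ` and zero on its kernel. -/
def suppPow {n : Type*} [Fintype n] [DecidableEq n] (σ : Matrix n n ℂ) (s : ℝ) : Matrix n n ℂ :=
  cfc (fun x : ℝ => if x = 0 then 0 else x ^ s) σ

/-- The support of a matrix: the orthogonal complement of its kernel. -/
def supp {n : Type*} [Fintype n] [DecidableEq n] (X : Matrix n n ℂ) :
    Submodule ℂ (EuclideanSpace ℂ n) :=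
  (LinearMap.ker (Matrix.toEuclideanLin X))ᗮ

/-- The exponent `(1 - α) / (2 α)`, with its limit `-1/2` at `α = ∞`. -/
def sandwichExp (α : ℝ≥0∞) : ℝ :=
  if α = ∞ then -1 / 2 else (1 - α.toReal) / (2 * α.toReal)

open Classical in
/-- `μ_α(X‖σ)`. -/
def mu {n : Type*} [Fintype n] [DecidableEq n] (α : ℝ≥0∞) (X σ : Matrix n n ℂ) : ℝ≥0∞ :=
  if supp X ≤ supp σ then
    ENNReal.ofReal
      (schattenNorm α (suppPow σ (sandwichExp α) * X * suppPow σ (sandwichExp α)))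
  else ∞

/-- `ν_α(X‖σ) = log₂ μ_α(X‖σ)`. -/
def nu {n : Type*} [Fintype n] [DecidableEq n] (α : ℝ≥0∞) (X σ : Matrix n n ℂ) : EReal :=
  ENNReal.log (mu α X σ) / ((Real.log 2 : ℝ) : EReal)

/-- The `α`-logarithmic negativity `E_N^α(A:B)` of `ρ`; for `α = ∞` it is the max-logarithmic
negativity. -/
def logNegativity (α : ℝ≥0∞) (a b : Type) [Fintype a] [DecidableEq a] [Fintype b] [DecidableEq b]
    (ρ : Matrix (a × b) (a × b) ℂ) : EReal :=
  ⨅ σ ∈ PPT a b, nu α (partialTranspose ρ) σ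

/-- The reduced operator `ρ_AB = Tr_C ρ_ABC`. -/
def reduceAB {a b c : Type*} [Fintype c] (ρ : Matrix (a × b × c) (a × b × c) ℂ) :
    Matrix (a × b) (a × b) ℂ :=
  Matrix.of fun i j => ∑ k, ρ (i.1, i.2, k) (j.1, j.2, k)

/-- The reduced operator `ρ_AC = Tr_B ρ_ABC`. -/
def reduceAC {a b c : Type*} [Fintype b] (ρ : Matrix (a × b × c) (a × b × c) ℂ) :
    Matrix (a × c) (a × c) ℂ :=
  Matrix.of fun i j => ∑ k, ρ (i.1, k, i.2) (j.1, k, j.2)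

/-- A measure `E` of bipartite states is monogamous if `E(A:B) + E(A:C) ≤ E(A:BC)` for every
tripartite state. -/
def IsMonogamous
    (E : ∀ (a b : Type) [Fintype a] [DecidableEq a] [Fintype b] [DecidableEq b],
      Matrix (a × b) (a × b) ℂ → EReal) : Prop :=
  ∀ (a b c : Type) [Fintype a] [DecidableEq a] [Fintype b] [DecidableEq b]
    [Fintype c] [DecidableEq c] (ρ : Matrix (a × b × c) (a × b × c) ℂ), IsState ρ →
    E a b (reduceAB ρ) + E a c (reduceAC ρ) ≤ E a (b × c) ρ

/-- The three-qubit vector `(|000⟩ + |011⟩ + √2 |110⟩) / 2`. -/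
def psi : Fin 2 × Fin 2 × Fin 2 → ℂ :=
  (1 / 2 : ℂ) • (Pi.single (0, 0, 0) 1 + Pi.single (0, 1, 1) 1
    + (Real.sqrt 2 : ℂ) • Pi.single (1, 1, 0) 1)

/-- The density matrix `|ψ⟩⟨ψ|`. -/
def psiState : Matrix (Fin 2 × Fin 2 × Fin 2) (Fin 2 × Fin 2 × Fin 2) ℂ :=
  Matrix.vecMulVec psi (star psi)

end AlphaLogNeg

end

/-! The value across A:BC is bounded above and the values of both marginals below, uniformly in α.
Upper bound: across A:BC, `psi` is maximally entangled of Schmidt rank d = 2, so its partial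
transpose X satisfies X² = P/d² for a projection P of rank d². The PPT state P/d² has a flat
spectrum, which gives μ_α = d for every α, hence a value of at most log₂ 2 = 1
(`mu_smul_projection_le`, `logNegativity_maxEntangled_le`). Lower bound: for a density matrix σ,
Hölder's inequality gives μ_α(X‖σ) ≥ ‖X‖₁ ≥ Re Tr(XW) for every Hermitian contraction W
(`re_trace_mul_le_schattenNorm`). Taking for W the sign of the partially transposed marginal yields
3/2 for both AB and AC (`le_logNegativity`). The sum is thus at least 2 log₂(3/2) = log₂(9/4) > 1.
-/

namespace AlphaLogNeg

variable {n : Type*} [Fintype n] [DecidableEq n]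

/-! ### Functional calculus in eigenbases -/

section FunctionalCalculus

lemma continuousOn_spectrum (f : ℝ → ℝ) (A : Matrix n n ℂ) :
    ContinuousOn f (spectrum ℝ A) :=
  A.finite_real_spectrum.continuousOn f

lemma cfc_mul_cfc (f g : ℝ → ℝ) (A : Matrix n n ℂ) :
    cfc f A * cfc g A = cfc (fun x => f x * g x) A :=
  (cfc_mul f g A (continuousOn_spectrum f A) (continuousOn_spectrum g A)).symm

lemma cfc_cfc (g f : ℝ → ℝ) {A : Matrix n n ℂ} (hA : A.IsHermitian) :
    cfc g (cfc f A) = cfc (fun x => g (f x)) A :=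
  (cfc_comp' g f A ((A.finite_real_spectrum.image f).continuousOn g)
    (continuousOn_spectrum f A) hA.isSelfAdjoint).symm

lemma isHermitian_cfc (f : ℝ → ℝ) (A : Matrix n n ℂ) : (cfc f A).IsHermitian :=
  cfc_predicate f A

lemma cfc_eq_conj (f : ℝ → ℝ) {A : Matrix n n ℂ} (hA : A.IsHermitian) :
    cfc f A = (hA.eigenvectorUnitary : Matrix n n ℂ) *
      Matrix.diagonal (fun i => ((f (hA.eigenvalues i) : ℝ) : ℂ)) *
        star (hA.eigenvectorUnitary : Matrix n n ℂ) := by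
  rw [hA.cfc_eq, Matrix.IsHermitian.cfc, Unitary.conjStarAlgAut_apply]
  rfl

lemma trace_cfc_mul (f : ℝ → ℝ) {A : Matrix n n ℂ} (hA : A.IsHermitian) (Z : Matrix n n ℂ) :
    (cfc f A * Z).trace = ∑ i, ((f (hA.eigenvalues i) : ℝ) : ℂ) *
      (star (hA.eigenvectorUnitary : Matrix n n ℂ) * Z * hA.eigenvectorUnitary) i i := by
  rw [cfc_eq_conj f hA, mul_assoc, mul_assoc, Matrix.trace_mul_comm, mul_assoc, Matrix.trace]
  simp only [Matrix.diag_apply, Matrix.diagonal_mul]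

lemma trace_cfc (f : ℝ → ℝ) {A : Matrix n n ℂ} (hA : A.IsHermitian) :
    (cfc f A).trace = ((∑ i, f (hA.eigenvalues i) : ℝ) : ℂ) := by
  have := trace_cfc_mul f hA 1
  simpa using this

/-- For unitary V the squared overlaps of the two eigenbases form a doubly stochastic matrix, the
weights needed for Hölder's inequality. -/
lemma conj_cfc_apply_diag (f : ℝ → ℝ) {A : Matrix n n ℂ} (hA : A.IsHermitian)
    (V : Matrix n n ℂ) (i : n) :
    (star V * cfc f A * V) i i = ((∑ j,
      ‖(star V * (hA.eigenvectorUnitary : Matrix n n ℂ)) i j‖ ^ 2 *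
        f (hA.eigenvalues j) : ℝ) : ℂ) := by
  set U : Matrix n n ℂ := hA.eigenvectorUnitary.1 with hU
  have h : star V * cfc f A * V = (star V * U) *
      Matrix.diagonal (fun i => ((f (hA.eigenvalues i) : ℝ) : ℂ)) * (star V * U)ᴴ := by
    rw [cfc_eq_conj f hA]
    simp only [Matrix.star_eq_conjTranspose, Matrix.conjTranspose_mul,
      Matrix.conjTranspose_conjTranspose, mul_assoc, hU]
  rw [h, Matrix.mul_apply]
  push_cast
  refine Finset.sum_congr rfl fun j _ => ?_
  rw [Matrix.mul_diagonal, Matrix.conjTranspose_apply, mul_right_comm, RCLike.star_def,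
    Complex.mul_conj, Complex.normSq_eq_norm_sq]
  push_cast
  rfl

lemma sum_norm_sq_row {G : Matrix n n ℂ} (hG : G ∈ Matrix.unitaryGroup n ℂ) (i : n) :
    ∑ j, ‖G i j‖ ^ 2 = 1 := by
  have h := congrFun (congrFun (Matrix.mem_unitaryGroup_iff.1 hG) i) i
  rw [Matrix.mul_apply, Matrix.one_apply_eq] at h
  simp only [Matrix.star_apply, RCLike.star_def, Complex.mul_conj, Complex.normSq_eq_norm_sq] at h
  exact_mod_cast h

lemma sum_norm_sq_col {G : Matrix n n ℂ} (hG : G ∈ Matrix.unitaryGroup n ℂ) (j : n) :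
    ∑ i, ‖G i j‖ ^ 2 = 1 := by
  have h := sum_norm_sq_row (Unitary.star_mem hG) j
  simpa [Matrix.star_apply] using h

end FunctionalCalculus

/-! ### Hölder's inequality with doubly stochastic weights -/

section Hoelder

/-- Hölder's inequality with doubly stochastic weights `w` against a probability vector `t`, whose
powers are taken on its support. -/
lemma sum_mul_sum_mul_rpow_le {m : Type*} [Fintype m] {p : ℝ} (hp : 1 ≤ p) {w : m → m → ℝ} (hw : ∀ i j, 0 ≤ w i j)
    (hrow : ∀ i, ∑ j, w i j = 1) (hcol : ∀ j, ∑ i, w i j = 1) {y t : m → ℝ} (hy : ∀ i, 0 ≤ y i)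
    (ht : ∀ j, 0 ≤ t j) (hsum : ∑ j, t j = 1) :
    ∑ i, y i * ∑ j, w i j * (if t j = 0 then 0 else t j ^ ((p - 1) / p)) ≤
      (∑ i, y i ^ p) ^ (1 / p) := by
  rcases hp.eq_or_lt with rfl | hp
  -- At p = 1 the conjugate exponent is infinite; the powers of t are 0 or 1, so the row sums
  -- suffice.
  · simp only [Real.rpow_one, sub_self, Real.rpow_zero, div_one]
    refine Finset.sum_le_sum fun i _ => mul_le_of_le_one_right (hy i) ?_
    refine (Finset.sum_le_sum fun j _ => mul_le_of_le_one_right (hw i j) ?_).trans_eq (hrow i)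
    split_ifs <;> norm_num
  · have hpq : p.HolderConjugate (p / (p - 1)) := Real.HolderConjugate.conjExponent hp
    have hp0 : p ≠ 0 := hpq.ne_zero
    have hp1 : p - 1 ≠ 0 := by linarith
    set q := p / (p - 1) with hq
    have hq0 : q ≠ 0 := hpq.symm.ne_zero
    have hqi : (p - 1) / p = 1 / q := by rw [hq]; field_simp
    have hadd : 1 / p + 1 / q = 1 := by rw [hq]; field_simp; ring
    have hpow : ∀ {r : ℝ}, r ≠ 0 → ∀ {x : ℝ}, 0 ≤ x → (x ^ (1 / r)) ^ r = x := by
      intro r hr x hx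
      rw [← Real.rpow_mul hx, one_div_mul_cancel hr, Real.rpow_one]
    -- Splitting w = w^(1/p) w^(1/q) over pairs (i, j) lets the row sums collapse the first factor
    -- to ∑ y^p and the column sums the second to ∑ t = 1.
    have key := Real.inner_le_Lp_mul_Lq_of_nonneg (Finset.univ : Finset (m × m))
      (f := fun k => w k.1 k.2 ^ (1 / p) * y k.1)
      (g := fun k => w k.1 k.2 ^ (1 / q) * t k.2 ^ (1 / q)) hpq
      (fun k _ => mul_nonneg (Real.rpow_nonneg (hw _ _) _) (hy _))
      (fun k _ => mul_nonneg (Real.rpow_nonneg (hw _ _) _) (Real.rpow_nonneg (ht _) _))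
    have hf : ∑ k : m × m, (w k.1 k.2 ^ (1 / p) * y k.1) ^ p = ∑ i, y i ^ p := by
      rw [Fintype.sum_prod_type]
      refine Finset.sum_congr rfl fun i _ => ?_
      calc ∑ j, (w i j ^ (1 / p) * y i) ^ p = ∑ j, w i j * y i ^ p :=
            Finset.sum_congr rfl fun j _ => by
              rw [Real.mul_rpow (Real.rpow_nonneg (hw _ _) _) (hy _), hpow hp0 (hw _ _)]
        _ = y i ^ p := by rw [← Finset.sum_mul, hrow, one_mul]
    have hg : ∑ k : m × m, (w k.1 k.2 ^ (1 / q) * t k.2 ^ (1 / q)) ^ q = 1 := by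
      rw [Fintype.sum_prod_type_right]
      refine (Finset.sum_congr rfl fun j _ => ?_).trans hsum
      calc ∑ i, (w i j ^ (1 / q) * t j ^ (1 / q)) ^ q = ∑ i, w i j * t j :=
            Finset.sum_congr rfl fun i _ => by
              rw [Real.mul_rpow (Real.rpow_nonneg (hw _ _) _) (Real.rpow_nonneg (ht _) _),
                hpow hq0 (hw _ _), hpow hq0 (ht _)]
        _ = t j := by rw [← Finset.sum_mul, hcol, one_mul]
    rw [hf, hg, Real.one_rpow, mul_one, Fintype.sum_prod_type] at key
    refine le_trans (Finset.sum_le_sum fun i _ => ?_) key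
    rw [Finset.mul_sum]
    refine Finset.sum_le_sum fun j _ => ?_
    have hw' : w i j ^ (1 / p) * w i j ^ (1 / q) = w i j := by
      rw [← Real.rpow_add' (hw i j) (by rw [hadd]; norm_num), hadd, Real.rpow_one]
    have ht' : (if t j = 0 then 0 else t j ^ ((p - 1) / p)) = t j ^ (1 / q) := by
      split_ifs with h
      · rw [h, Real.zero_rpow (one_div_ne_zero hq0)]
      · rw [hqi]
    rw [ht']
    apply le_of_eq
    calc y i * (w i j * t j ^ (1 / q))
        = y i * ((w i j ^ (1 / p) * w i j ^ (1 / q)) * t j ^ (1 / q)) := by rw [hw']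
      _ = _ := by ring

end Hoelder

/-! ### Schatten norms of Hermitian matrices -/

section SchattenNorm

lemma matAbs_eq_cfc {Y : Matrix n n ℂ} (hY : Y.IsHermitian) :
    matAbs Y = cfc (fun x : ℝ => |x|) Y := by
  have h : Yᴴ * Y = cfc (fun x : ℝ => x * x) Y := by
    rw [hY.eq, ← cfc_mul_cfc (fun x => x) (fun x => x), cfc_id' ℝ Y hY.isSelfAdjoint]
  rw [matAbs, h, cfc_cfc _ _ hY]
  simp only [Real.sqrt_mul_self_eq_abs]

lemma schattenNorm_eq_sum {α : ℝ≥0∞} (hα : α ≠ ∞) {Y : Matrix n n ℂ} (hY : Y.IsHermitian) :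
    schattenNorm α Y = (∑ i, |hY.eigenvalues i| ^ α.toReal) ^ (1 / α.toReal) := by
  rw [schattenNorm, if_neg hα, matAbs_eq_cfc hY, cfc_cfc _ _ hY, trace_cfc _ hY, Complex.ofReal_re]

lemma abs_eigenvalue_le_schattenNorm_top {Y : Matrix n n ℂ} (hY : Y.IsHermitian) (i : n) :
    |hY.eigenvalues i| ≤ schattenNorm ∞ Y := by
  rw [schattenNorm, if_pos rfl]
  have h := (Matrix.toEuclideanCLM (n := n) (𝕜 := ℂ) Y).le_opNorm (hY.eigenvectorBasis i)
  have h' : Matrix.toEuclideanCLM (n := n) (𝕜 := ℂ) Y (hY.eigenvectorBasis i) =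
      (hY.eigenvalues i : ℂ) • hY.eigenvectorBasis i := by
    apply (WithLp.ofLp_injective 2)
    rw [Matrix.ofLp_toEuclideanCLM, hY.mulVec_eigenvectorBasis]
    ext k
    simp
  rw [h', norm_smul, (hY.eigenvectorBasis.orthonormal).1 i, mul_one, mul_one] at h
  simpa using h

end SchattenNorm

/-! ### Lower bound by the trace norm -/

section LowerBound

lemma isHermitian_suppPow (σ : Matrix n n ℂ) (s : ℝ) : (suppPow σ s).IsHermitian :=
  isHermitian_cfc _ _

lemma suppPow_mul {σ : Matrix n n ℂ} (hσ : σ.PosSemidef) (s r : ℝ) :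
    suppPow σ s * suppPow σ r = suppPow σ (s + r) := by
  rw [suppPow, suppPow, suppPow, cfc_mul_cfc]
  apply cfc_congr
  intro x hx
  rw [hσ.1.spectrum_real_eq_range_eigenvalues] at hx
  obtain ⟨i, rfl⟩ := hx
  have h := hσ.eigenvalues_nonneg i
  by_cases h0 : hσ.1.eigenvalues i = 0
  · simp [h0]
  · simp only [if_neg h0]
    rw [Real.rpow_add (lt_of_le_of_ne h (Ne.symm h0))]

lemma suppPow_one {σ : Matrix n n ℂ} (hσ : σ.IsHermitian) : suppPow σ 1 = σ := by
  rw [suppPow]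
  conv_rhs => rw [← cfc_id' ℝ σ hσ.isSelfAdjoint]
  congr 1
  ext x
  split_ifs with h <;> simp [h]

/-- σ⁰ is the projection onto the support of σ, so the columns of 1 - σ⁰ lie in ker σ, hence in ker
X. -/
lemma mul_suppPow_zero {X σ : Matrix n n ℂ} (hσ : σ.PosSemidef) (h : supp X ≤ supp σ) :
    X * suppPow σ 0 = X := by
  have hker : LinearMap.ker (Matrix.toEuclideanLin σ) ≤ LinearMap.ker (Matrix.toEuclideanLin X) :=
    (Submodule.orthogonal_le_orthogonal_iff).1 h
  have hσP : σ * (1 - suppPow σ 0) = 0 := by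
    have := suppPow_mul hσ 1 0
    rw [add_zero, suppPow_one hσ.1] at this
    rw [mul_sub, mul_one, this, sub_self]
  have hXP : X * (1 - suppPow σ 0) = 0 := by
    ext i j
    have hm : WithLp.toLp 2 (fun k => (1 - suppPow σ 0) k j) ∈
        LinearMap.ker (Matrix.toEuclideanLin σ) := by
      rw [LinearMap.mem_ker]
      ext i
      exact congrFun (congrFun hσP i) j
    have hm' := hker hm
    rw [LinearMap.mem_ker] at hm'
    exact congrArg (fun v : EuclideanSpace ℂ n => v i) hm'
  rw [mul_sub, mul_one, sub_eq_zero] at hXP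
  exact hXP.symm

lemma abs_re_conj_diag_le {W : Matrix n n ℂ} (h₁ : (1 - W).PosSemidef) (h₂ : (1 + W).PosSemidef)
    (C : Matrix n n ℂ) (i : n) : |((Cᴴ * W * C) i i).re| ≤ ((Cᴴ * C) i i).re := by
  have e₁ := (Complex.le_def.1 ((h₁.conjTranspose_mul_mul_same C).diag_nonneg (i := i))).1
  have e₂ := (Complex.le_def.1 ((h₂.conjTranspose_mul_mul_same C).diag_nonneg (i := i))).1
  rw [mul_sub, sub_mul, mul_one, Matrix.sub_apply, Complex.sub_re, Complex.zero_re] at e₁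
  rw [mul_add, add_mul, mul_one, Matrix.add_apply, Complex.add_re, Complex.zero_re] at e₂
  rw [abs_le]
  constructor <;> linarith

lemma sandwichExp_of_ne_top {α : ℝ≥0∞} (hα : α ≠ ∞) :
    sandwichExp α = (1 - α.toReal) / (2 * α.toReal) := if_neg hα

/-- For a density matrix `σ`, the sandwiched `α`-norm dominates the trace norm, here tested
against a Hermitian contraction `W`. -/
theorem re_trace_mul_le_schattenNorm {α : ℝ≥0∞} (hα : 1 ≤ α) {X σ W : Matrix n n ℂ}
    (hX : X.IsHermitian) (hσ : IsState σ) (hsupp : supp X ≤ supp σ)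
    (h₁ : (1 - W).PosSemidef) (h₂ : (1 + W).PosSemidef) :
    (X * W).trace.re ≤
      schattenNorm α (suppPow σ (sandwichExp α) * X * suppPow σ (sandwichExp α)) := by
  obtain ⟨hσ, htr⟩ := hσ
  set s := sandwichExp α with hs
  set R := suppPow σ s with hR
  set D := suppPow σ (-s) with hD
  set Y := R * X * R with hYdef
  have hRH : Rᴴ = R := isHermitian_suppPow σ s
  have hDH : Dᴴ = D := isHermitian_suppPow σ (-s)
  have hY : Y.IsHermitian := by
    rw [Matrix.IsHermitian, hYdef, Matrix.conjTranspose_mul, Matrix.conjTranspose_mul, hRH, hX.eq,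
      mul_assoc]
  have hXP : X * suppPow σ 0 = X := mul_suppPow_zero hσ hsupp
  have hPX : suppPow σ 0 * X = X := by
    have := congrArg Matrix.conjTranspose hXP
    rwa [Matrix.conjTranspose_mul, hX.eq, (isHermitian_suppPow σ 0).eq] at this
  -- The support condition makes the sandwiching by R invertible, with D as generalized inverse of
  -- R.
  have hDYD : D * Y * D = X := by
    have e₁ : D * R = suppPow σ 0 := by rw [hD, hR, suppPow_mul hσ, neg_add_cancel]
    have e₂ : R * D = suppPow σ 0 := by rw [hD, hR, suppPow_mul hσ, add_neg_cancel]
    calc D * Y * D = (D * R) * X * (R * D) := by simp only [hYdef, mul_assoc]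
      _ = X := by rw [e₁, e₂, hPX, hXP]
  set V : Matrix n n ℂ := hY.eigenvectorUnitary.1 with hV
  set T : Matrix n n ℂ := hσ.1.eigenvectorUnitary.1 with hT
  have hG : star V * T ∈ Matrix.unitaryGroup n ℂ :=
    mul_mem (Unitary.star_mem hY.eigenvectorUnitary.2) hσ.1.eigenvectorUnitary.2
  set w : n → n → ℝ := fun i j => ‖(star V * T) i j‖ ^ 2 with hw
  set t := hσ.1.eigenvalues with ht
  have hDD : D * D = suppPow σ (-(2 * s)) := by
    rw [hD, suppPow_mul hσ]; congr 1; ring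
  have htrace : (X * W).trace = ∑ i, (hY.eigenvalues i : ℂ) * ((D * V)ᴴ * W * (D * V)) i i := by
    have e : (X * W).trace = (Y * (D * W * D)).trace := by
      rw [← hDYD, mul_assoc, mul_assoc, Matrix.trace_mul_comm]
      simp only [mul_assoc]
    rw [e]
    conv_lhs => rw [← cfc_id' ℝ Y hY.isSelfAdjoint]
    rw [trace_cfc_mul _ hY]
    refine Finset.sum_congr rfl fun i _ => ?_
    rw [Matrix.conjTranspose_mul, hDH, Matrix.star_eq_conjTranspose]
    simp only [mul_assoc, hV]
  have hdiag : ∀ i, (((D * V)ᴴ * (D * V)) i i).re =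
      ∑ j, w i j * (if t j = 0 then 0 else t j ^ (-(2 * s))) := by
    intro i
    have e : (D * V)ᴴ * (D * V) = star V * suppPow σ (-(2 * s)) * V := by
      rw [Matrix.conjTranspose_mul, hDH, ← hDD, Matrix.star_eq_conjTranspose]
      simp only [mul_assoc]
    rw [e, suppPow, conj_cfc_apply_diag _ hσ.1, Complex.ofReal_re]
  -- Tr(XW) = Tr(Y·DWD) is expanded in the eigenbasis of Y; since -1 ≤ W ≤ 1, each diagonal entry of
  -- DWD is bounded by that of D² = σ^(-2s).
  have hbound : (X * W).trace.re ≤ ∑ i, |hY.eigenvalues i| *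
      ∑ j, w i j * (if t j = 0 then 0 else t j ^ (-(2 * s))) := by
    rw [htrace, Complex.re_sum]
    refine Finset.sum_le_sum fun i _ => ?_
    rw [Complex.re_ofReal_mul, ← hdiag]
    refine (le_abs_self _).trans ?_
    rw [abs_mul]
    exact mul_le_mul_of_nonneg_left (abs_re_conj_diag_le h₁ h₂ _ i) (abs_nonneg _)
  have hw0 : ∀ i j, 0 ≤ w i j := fun i j => by positivity
  have ht0 : ∀ j, 0 ≤ t j := hσ.eigenvalues_nonneg
  have htsum : ∑ j, t j = 1 := by
    have := hσ.1.trace_eq_sum_eigenvalues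
    rw [htr] at this
    simpa [Complex.re_sum] using (congrArg Complex.re this).symm
  refine hbound.trans ?_
  by_cases hα' : α = ∞
  · subst hα'
    have hs' : -(2 * s) = 1 := by rw [hs, sandwichExp, if_pos rfl]; norm_num
    have hif : ∀ j, (if t j = 0 then 0 else t j ^ (-(2 * s))) = t j := by
      intro j
      rw [hs', Real.rpow_one]
      split_ifs with h
      · exact h.symm
      · rfl
    simp only [hif]
    calc ∑ i, |hY.eigenvalues i| * ∑ j, w i j * t j
        ≤ ∑ i, schattenNorm ∞ Y * ∑ j, w i j * t j :=
          Finset.sum_le_sum fun i _ => mul_le_mul_of_nonneg_right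
            (abs_eigenvalue_le_schattenNorm_top hY i)
            (Finset.sum_nonneg fun j _ => mul_nonneg (hw0 i j) (ht0 j))
      _ = schattenNorm ∞ Y := by
          rw [← Finset.mul_sum, Finset.sum_comm]
          simp only [← Finset.sum_mul]
          simp only [hw, sum_norm_sq_col hG, one_mul, htsum, mul_one]
  · have hp : 1 ≤ α.toReal := by
      have := (ENNReal.toReal_le_toReal ENNReal.one_ne_top hα').2 hα
      simpa using this
    have hs' : -(2 * s) = (α.toReal - 1) / α.toReal := by
      rw [hs, sandwichExp_of_ne_top hα']
      field_simp
      ring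
    rw [schattenNorm_eq_sum hα' hY, hs']
    exact sum_mul_sum_mul_rpow_le hp hw0 (sum_norm_sq_row hG) (sum_norm_sq_col hG)
      (fun i => abs_nonneg _) ht0 htsum

lemma ofReal_re_trace_mul_le_mu {α : ℝ≥0∞} (hα : 1 ≤ α) {X σ W : Matrix n n ℂ}
    (hX : X.IsHermitian) (hσ : IsState σ)
    (h₁ : (1 - W).PosSemidef) (h₂ : (1 + W).PosSemidef) :
    ENNReal.ofReal (X * W).trace.re ≤ mu α X σ := by
  rw [mu]
  split_ifs with h
  · exact ENNReal.ofReal_le_ofReal (re_trace_mul_le_schattenNorm hα hX hσ h h₁ h₂)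
  · exact le_top

/-- W² = 1 gives 1 - W = (1 - W)²/2, a positive multiple of a Hermitian square. -/
lemma posSemidef_one_sub_of_involution {W : Matrix n n ℂ} (hW : W.IsHermitian) (h : W * W = 1) :
    (1 - W).PosSemidef := by
  have e : (1 - W) = (1 / 2 : ℝ) • ((1 - W)ᴴ * (1 - W)) := by
    rw [Matrix.conjTranspose_sub, Matrix.conjTranspose_one, hW.eq, mul_sub, sub_mul, sub_mul, h]
    simp only [one_mul, mul_one]
    module
  rw [e]
  exact (Matrix.posSemidef_conjTranspose_mul_self _).smul (by norm_num)

lemma log_two_pos_ereal : (0 : EReal) < ((Real.log 2 : ℝ) : EReal) := by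
  exact_mod_cast Real.log_pos one_lt_two

/-- A Hermitian involution `W` witnesses a lower bound on the `α`-logarithmic negativity. -/
theorem le_logNegativity {α : ℝ≥0∞} (hα : 1 ≤ α) {a b : Type} [Fintype a] [DecidableEq a]
    [Fintype b] [DecidableEq b] {ρ W : Matrix (a × b) (a × b) ℂ}
    (hρ : (partialTranspose ρ).IsHermitian) (hW : W.IsHermitian) (hWW : W * W = 1) {r : ℝ}
    (hr : 0 < r) (htr : (partialTranspose ρ * W).trace = r) :
    ((Real.log r / Real.log 2 : ℝ) : EReal) ≤ logNegativity α a b ρ := by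
  refine le_iInf₂ fun σ hσ => ?_
  rw [nu, EReal.coe_div, ← ENNReal.log_ofReal_of_pos hr]
  refine EReal.div_le_div_right_of_nonneg log_two_pos_ereal.le (ENNReal.log_le_log ?_)
  have h := ofReal_re_trace_mul_le_mu hα hρ ⟨hσ.1, hσ.2.2⟩
    (posSemidef_one_sub_of_involution hW hWW)
    (by simpa using posSemidef_one_sub_of_involution hW.neg (by simpa using hWW))
  rwa [htr, Complex.ofReal_re] at h

end LowerBound

end AlphaLogNeg

namespace AlphaLogNeg

/-! ### Upper bound from a flat state -/

section UpperBound

variable {n : Type*} [Fintype n] [DecidableEq n]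

/-- The spectrum of P lies in {0, 1}, where x ↦ f (c x) and x ↦ f(c) x agree because f vanishes at
0. -/
lemma cfc_smul_of_isIdempotent {P : Matrix n n ℂ} (hP : P.IsHermitian) (hPP : P * P = P) (c : ℝ)
    {f : ℝ → ℝ} (hf : f 0 = 0) : cfc f (c • P) = f c • P := by
  have hid : ∀ r : ℝ, cfc (fun x : ℝ => r * x) P = r • P := fun r => cfc_const_mul_id r P
  rw [← hid, cfc_cfc _ _ hP, ← hid]
  apply cfc_congr
  intro x hx
  have hx' : x * x = x := by
    rw [hP.spectrum_real_eq_range_eigenvalues] at hx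
    obtain ⟨i, rfl⟩ := hx
    have h := hP.mulVec_eigenvectorBasis i
    have h2 : P *ᵥ (P *ᵥ ⇑(hP.eigenvectorBasis i)) = P *ᵥ ⇑(hP.eigenvectorBasis i) := by
      rw [Matrix.mulVec_mulVec, hPP]
    rw [h, Matrix.mulVec_smul, h, smul_smul] at h2
    refine smul_left_injective ℝ (fun h0 => ?_) h2
    exact hP.eigenvectorBasis.orthonormal.ne_zero i (WithLp.ofLp_injective 2 h0)
  have hx01 : x = 0 ∨ x = 1 := by
    rcases eq_or_ne x 0 with h | h
    · exact Or.inl h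
    · exact Or.inr (mul_left_cancel₀ h (by rw [hx', mul_one]))
  rcases hx01 with rfl | rfl <;> simp [hf]

open scoped Matrix.Norms.L2Operator in
-- The C⋆-identity gives ‖Y‖² = c²‖P‖, and ‖P‖ ≤ 1 for a projection.
lemma norm_toEuclideanCLM_le_of_conjTranspose_mul_self {P Y : Matrix n n ℂ} (hP : P.IsHermitian)
    (hPP : P * P = P) {c : ℝ} (hc : 0 ≤ c) (hY : Yᴴ * Y = (c ^ 2) • P) :
    ‖Matrix.toEuclideanCLM (n := n) (𝕜 := ℂ) Y‖ ≤ c := by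
  rw [Matrix.l2_opNorm_toEuclideanCLM]
  have h1 : ‖P‖ ≤ 1 := by
    have h := Matrix.l2_opNorm_conjTranspose_mul_self P
    rw [hP.eq, hPP] at h
    nlinarith [norm_nonneg P]
  have h2 := Matrix.l2_opNorm_conjTranspose_mul_self Y
  rw [hY, show (c ^ 2) • P = ((c ^ 2 : ℝ) : ℂ) • P from (Complex.coe_smul _ _).symm,
    norm_smul, Complex.norm_real, Real.norm_of_nonneg (by positivity)] at h2
  nlinarith [norm_nonneg Y, sq_nonneg c]

/-- If `X` is Hermitian with `X² = c² P` for a projection `P` of rank `d`, then `σ = P / d`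
achieves `μ_α(X‖σ) ≤ c d` for all `α`. -/
lemma mu_smul_projection_le {α : ℝ≥0∞} (hα : 1 ≤ α) {P X : Matrix n n ℂ} (hP : P.IsHermitian)
    (hPP : P * P = P) {d c : ℝ} (hd : 0 < d) (hc : 0 < c) (htr : P.trace = d) (hX : X.IsHermitian)
    (hXX : X * X = (c ^ 2) • P) (hXP : X * P = X) :
    mu α X ((1 / d) • P) ≤ ENNReal.ofReal (c * d) := by
  have hPX : P * X = X := by
    have := congrArg Matrix.conjTranspose hXP
    rwa [Matrix.conjTranspose_mul, hX.eq, hP.eq] at this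
  have hsupp : supp X ≤ supp ((1 / d) • P) := by
    refine Submodule.orthogonal_le fun v hv => ?_
    rw [LinearMap.mem_ker] at hv ⊢
    have hv' : ((1 / d) • P) *ᵥ v.ofLp = 0 := congrArg WithLp.ofLp hv
    have hX' : X = X * (d • ((1 / d) • P)) := by
      rw [smul_smul, mul_one_div_cancel hd.ne', one_smul, hXP]
    apply WithLp.ofLp_injective 2
    change X *ᵥ v.ofLp = 0
    rw [hX', ← Matrix.mulVec_mulVec, Matrix.smul_mulVec, hv', smul_zero, Matrix.mulVec_zero]
  rw [mu, if_pos hsupp]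
  apply ENNReal.ofReal_le_ofReal
  set s := sandwichExp α with hs
  have hd' : 0 < 1 / d := by positivity
  have hpow : suppPow ((1 / d) • P) s = ((1 / d) ^ s) • P := by
    rw [suppPow, cfc_smul_of_isIdempotent hP hPP _ (by simp), if_neg hd'.ne']
  set k : ℝ := (1 / d) ^ s with hk
  have hk0 : 0 < k := Real.rpow_pos_of_pos hd' s
  have hY : suppPow ((1 / d) • P) s * X * suppPow ((1 / d) • P) s = (k ^ 2) • X := by
    rw [hpow, smul_mul_assoc, smul_mul_smul_comm, hPX, hXP, sq]
  rw [hY]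
  have hYY : ((k ^ 2) • X)ᴴ * ((k ^ 2) • X) = ((k ^ 2 * c) ^ 2) • P := by
    rw [Matrix.conjTranspose_smul, hX.eq, smul_mul_smul_comm, hXX, smul_smul, star_trivial]
    congr 1
    ring
  have hk2 : k ^ 2 = d ^ (-(2 * s)) := by
    rw [hk, one_div, Real.inv_rpow hd.le, ← Real.rpow_neg hd.le, ← Real.rpow_natCast,
      ← Real.rpow_mul hd.le]
    congr 1
    push_cast
    ring
  by_cases hα' : α = ∞
  · rw [schattenNorm, if_pos hα']
    refine (norm_toEuclideanCLM_le_of_conjTranspose_mul_self hP hPP (by positivity) hYY).trans_eq ?_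
    rw [hk2, hs, sandwichExp, if_pos hα', show (-(2 * (-1 / 2 : ℝ))) = 1 by norm_num, Real.rpow_one,
      mul_comm]
  · have hp : 1 ≤ α.toReal := by
      have := (ENNReal.toReal_le_toReal ENNReal.one_ne_top hα').2 hα
      simpa using this
    have hp0 : α.toReal ≠ 0 := by positivity
    have hkc : 0 ≤ k ^ 2 * c := by positivity
    rw [schattenNorm, if_neg hα', matAbs, hYY, cfc_smul_of_isIdempotent hP hPP _ Real.sqrt_zero,
      Real.sqrt_sq hkc, 
      cfc_smul_of_isIdempotent hP hPP _ (f := fun x : ℝ => x ^ α.toReal) (Real.zero_rpow hp0),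
      Matrix.trace_smul, htr, Complex.real_smul, ← Complex.ofReal_mul, Complex.ofReal_re,
      Real.mul_rpow (by positivity) hd.le, ← Real.rpow_mul hkc, mul_one_div_cancel hp0,
      Real.rpow_one, hk2, mul_right_comm, ← Real.rpow_add hd, mul_comm c]
    -- The sandwich contributes d^(-2s) and the trace d^(1/α); the exponents add up to 1, so α drops
    -- out.
    apply le_of_eq
    congr 1
    rw [hs, sandwichExp_of_ne_top hα', show -(2 * ((1 - α.toReal) / (2 * α.toReal))) +
      1 / α.toReal = 1 by field_simp; ring, Real.rpow_one]

end UpperBound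

/-! ### Maximally entangled states -/

section MaximallyEntangled

variable {a b : Type} [Fintype a] [DecidableEq a] [Fintype b] [DecidableEq b]

/-- The vector `∑ i, |i⟩ ⊗ |f i⟩ / √|a|`. -/
noncomputable def maxEntangled (f : a → b → ℝ) : a × b → ℂ :=
  fun i => ((f i.1 i.2 / Real.sqrt (Fintype.card a) : ℝ) : ℂ)

/-- The projection `1 ⊗ ∑ k, |f k⟩⟨f k|`. -/
def rangeProjection (f : a → b → ℝ) : Matrix (a × b) (a × b) ℂ :=
  Matrix.of fun i j => if i.1 = j.1 then ((∑ k, f k i.2 * f k j.2 : ℝ) : ℂ) else 0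

/-- A maximally entangled pure state of Schmidt rank `d` has `α`-logarithmic negativity at most
`log₂ d`. -/
theorem logNegativity_maxEntangled_le [Nonempty a] {α : ℝ≥0∞} (hα : 1 ≤ α) {f : a → b → ℝ}
    (hf : ∀ i j, ∑ x, f i x * f j x = if i = j then 1 else 0) :
    logNegativity α a b (Matrix.vecMulVec (maxEntangled f) (star (maxEntangled f))) ≤
      ((Real.log (Fintype.card a) / Real.log 2 : ℝ) : EReal) := by
  set d := (Fintype.card a : ℝ) with hd
  have hd0 : 0 < d := by rw [hd]; exact_mod_cast Fintype.card_pos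
  set P := rangeProjection f with hP
  set X := partialTranspose (Matrix.vecMulVec (maxEntangled f) (star (maxEntangled f))) with hX
  have hXapply : ∀ i j, X i j = ((f i.1 j.2 * f j.1 i.2 / d : ℝ) : ℂ) := by
    intro i j
    simp only [hX, partialTranspose, Matrix.of_apply, Matrix.vecMulVec_apply, Pi.star_apply,
      maxEntangled, RCLike.star_def, Complex.conj_ofReal, ← hd]
    rw [← Complex.ofReal_mul, div_mul_div_comm, Real.mul_self_sqrt hd0.le]
  have hPapply : ∀ i j, P i j =
      ((if i.1 = j.1 then ∑ k, f k i.2 * f k j.2 else 0 : ℝ) : ℂ) := by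
    intro i j
    simp only [hP, rangeProjection, Matrix.of_apply]
    split_ifs <;> simp
  have hPH : P.IsHermitian := by
    ext i j
    rw [Matrix.conjTranspose_apply, hPapply, hPapply, RCLike.star_def, Complex.conj_ofReal]
    simp only [eq_comm, mul_comm]
  have hXH : X.IsHermitian := by
    ext i j
    rw [Matrix.conjTranspose_apply, hXapply, hXapply, RCLike.star_def, Complex.conj_ofReal,
      mul_comm (f j.1 i.2)]
  have hXX : X * X = ((1 / d) ^ 2) • P := by
    ext i j
    rw [Matrix.mul_apply, Matrix.smul_apply, hPapply, Complex.real_smul]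
    simp only [hXapply]
    norm_cast
    rw [Fintype.sum_prod_type]
    have h : ∀ k, ∑ x, f i.1 x * f k i.2 / d * (f k j.2 * f j.1 x / d) =
        (1 / d) ^ 2 * ((f k i.2 * f k j.2) * ∑ x, f i.1 x * f j.1 x) := by
      intro k
      rw [Finset.mul_sum, Finset.mul_sum]
      refine Finset.sum_congr rfl fun x _ => ?_
      ring
    simp only [h, hf, ← Finset.mul_sum, ← Finset.sum_mul]
    split_ifs <;> simp
  have hXP : X * P = X := by
    ext i j
    rw [Matrix.mul_apply]
    simp only [hXapply, hPapply]
    norm_cast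
    rw [Fintype.sum_prod_type_right]
    simp only [mul_ite, mul_zero, Finset.sum_ite_eq', Finset.mem_univ, if_true]
    have h : ∀ x, f i.1 x * f j.1 i.2 / d * ∑ k, f k x * f k j.2 =
        ∑ k, f j.1 i.2 / d * f k j.2 * (f i.1 x * f k x) := by
      intro x
      rw [Finset.mul_sum]
      refine Finset.sum_congr rfl fun k _ => ?_
      ring
    simp only [h]
    rw [Finset.sum_comm]
    simp only [← Finset.mul_sum, hf, mul_ite, mul_one, mul_zero, Finset.sum_ite_eq,
      Finset.mem_univ, if_true]
    ring
  -- P is d² X² and X P = X, so idempotence needs no further sums.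
  have hPP : P * P = P := by
    have h : P = (d ^ 2) • (X * X) := by
      rw [hXX, smul_smul, ← mul_pow, mul_one_div_cancel hd0.ne', one_pow, one_smul]
    calc P * P = (d ^ 2) • (X * (X * P)) := by
          rw [← mul_assoc, ← smul_mul_assoc, ← h]
      _ = P := by rw [hXP, ← h]
  have htr : P.trace = ((d * d : ℝ) : ℂ) := by
    rw [Matrix.trace]
    simp only [Matrix.diag_apply, hPapply, if_true]
    norm_cast
    rw [Fintype.sum_prod_type, Finset.sum_congr rfl fun i _ => Finset.sum_comm]
    simp [hf, hd]
  have hPpos : P.PosSemidef := by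
    have := Matrix.posSemidef_conjTranspose_mul_self P
    rwa [hPH.eq, hPP] at this
  -- The second factor of P is real symmetric, so transposing it changes nothing.
  have hPT : partialTranspose P = P := by
    ext i j
    simp only [partialTranspose, Matrix.of_apply, hPapply, mul_comm]
  have hdd : 0 < d * d := mul_pos hd0 hd0
  have hσ : (1 / (d * d)) • P ∈ PPT a b := by
    have h1 : ((1 / (d * d)) • P).PosSemidef := hPpos.smul (by positivity)
    refine ⟨h1, ?_, ?_⟩
    · have : partialTranspose ((1 / (d * d)) • P) = (1 / (d * d)) • partialTranspose P := rfl
      rwa [this, hPT]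
    · rw [Matrix.trace_smul, htr, Complex.real_smul, ← Complex.ofReal_mul,
        one_div_mul_cancel hdd.ne', Complex.ofReal_one]
  refine (iInf₂_le _ hσ).trans ?_
  rw [nu, EReal.coe_div, ← ENNReal.log_ofReal_of_pos hd0]
  refine EReal.div_le_div_right_of_nonneg log_two_pos_ereal.le (ENNReal.log_le_log ?_)
  have := mu_smul_projection_le hα hPH hPP hdd (one_div_pos.2 hd0) htr hXH hXX hXP
  rwa [← mul_assoc, one_div_mul_cancel hd0.ne', one_mul] at this

end MaximallyEntangled

/-! ### The three-qubit state and its sign witnesses -/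

section ThreeQubit

lemma psi_apply (i j k : Fin 2) : psi (i, j, k) =
    ![![![1 / 2, 0], ![0, 1 / 2]], ![![0, 0], ![(Real.sqrt 2 / 2 : ℝ), 0]]] i j k := by
  fin_cases i <;> fin_cases j <;> fin_cases k <;>
    simp [psi, div_eq_inv_mul]

/-- The Schmidt vectors `(|00⟩ + |11⟩) / √2` and `|10⟩` of `psi` on `BC`. -/
noncomputable def schmidtVec (i : Fin 2) (x : Fin 2 × Fin 2) : ℝ :=
  ![![![Real.sqrt 2 / 2, 0], ![0, Real.sqrt 2 / 2]], ![![0, 0], ![1, 0]]] i x.1 x.2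

lemma sqrt_two_mul_self : (Real.sqrt 2 : ℂ) * Real.sqrt 2 = 2 := by
  rw [← Complex.ofReal_mul, Real.mul_self_sqrt zero_le_two, Complex.ofReal_ofNat]

lemma schmidtVec_orthonormal (i j : Fin 2) :
    ∑ x, schmidtVec i x * schmidtVec j x = if i = j then 1 else 0 := by
  have h : Real.sqrt 2 * Real.sqrt 2 = 2 := Real.mul_self_sqrt zero_le_two
  rw [Fintype.sum_prod_type]
  fin_cases i <;> fin_cases j <;> simp [schmidtVec, Fin.sum_univ_two]
  linarith

/-- The BC components at |0⟩ and |1⟩ of A are orthogonal and both have norm 1/√2, so the Schmidt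
coefficients across A:BC are equal. -/
lemma psi_eq_maxEntangled : psi = maxEntangled schmidtVec := by
  have h : (2 : ℂ)⁻¹ = (Real.sqrt 2 : ℂ) / 2 / (Real.sqrt 2 : ℂ) := by
    have h0 : (Real.sqrt 2 : ℂ) ≠ 0 := by simp
    field_simp
  have h' : 1 / Real.sqrt 2 = Real.sqrt 2 / 2 := by
    rw [div_eq_div_iff (by positivity) (by positivity), Real.mul_self_sqrt zero_le_two, one_mul]
  ext ⟨i, j, k⟩
  rw [psi_apply, maxEntangled]
  fin_cases i <;> fin_cases j <;> fin_cases k <;> simp [schmidtVec]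
  all_goals first | exact h | exact_mod_cast by simp_all

lemma isState_psiState : IsState psiState := by
  refine ⟨Matrix.posSemidef_vecMulVec_self_star psi, ?_⟩
  rw [psiState, Matrix.trace_vecMulVec, dotProduct, Fintype.sum_prod_type]
  simp only [Fintype.sum_prod_type, Fin.sum_univ_two, Pi.star_apply, psi_apply]
  simp
  linear_combination (1 / 4) * sqrt_two_mul_self

/-- The Hermitian sign of `partialTranspose (reduceAB psiState)`. -/
noncomputable def signAB : Matrix (Fin 2 × Fin 2) (Fin 2 × Fin 2) ℂ :=
  -- On span{|01⟩, |10⟩} the partial transpose is M = [[1/4, √2/4], [√2/4, 0]] with eigenvalues 1/2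
  -- and -1/4, so its sign is (8/3)(M - 1/8).
  Matrix.of fun i j => ![![![![1, 0], ![0, 0]], ![![0, 1 / 3], ![2 * (Real.sqrt 2 : ℝ) / 3, 0]]],
    ![![![0, 2 * (Real.sqrt 2 : ℝ) / 3], ![-1 / 3, 0]], ![![0, 0], ![0, 1]]]] i.1 i.2 j.1 j.2

/-- The Hermitian sign of `partialTranspose (reduceAC psiState)`. -/
noncomputable def signAC : Matrix (Fin 2 × Fin 2) (Fin 2 × Fin 2) ℂ :=
  -- The same 2 × 2 block M now sits on span{|00⟩, |11⟩}.
  Matrix.of fun i j => ![![![![1 / 3, 0], ![0, 2 * (Real.sqrt 2 : ℝ) / 3]], ![![0, 1], ![0, 0]]],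
    ![![![0, 0], ![1, 0]], ![![2 * (Real.sqrt 2 : ℝ) / 3, 0], ![0, -1 / 3]]]] i.1 i.2 j.1 j.2

lemma isHermitian_signAB : signAB.IsHermitian := by
  ext ⟨i, j⟩ ⟨k, l⟩
  fin_cases i <;> fin_cases j <;> fin_cases k <;> fin_cases l <;> simp [signAB]

lemma isHermitian_signAC : signAC.IsHermitian := by
  ext ⟨i, j⟩ ⟨k, l⟩
  fin_cases i <;> fin_cases j <;> fin_cases k <;> fin_cases l <;> simp [signAC]

lemma signAB_mul_self : signAB * signAB = 1 := by
  ext ⟨i, j⟩ ⟨k, l⟩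
  rw [Matrix.mul_apply, Fintype.sum_prod_type, Matrix.one_apply]
  fin_cases i <;> fin_cases j <;> fin_cases k <;> fin_cases l <;>
    simp [signAB, Fin.sum_univ_two]
  all_goals first | ring1 | linear_combination (4 / 9) * sqrt_two_mul_self

lemma signAC_mul_self : signAC * signAC = 1 := by
  ext ⟨i, j⟩ ⟨k, l⟩
  rw [Matrix.mul_apply, Fintype.sum_prod_type, Matrix.one_apply]
  fin_cases i <;> fin_cases j <;> fin_cases k <;> fin_cases l <;>
    simp [signAC, Fin.sum_univ_two]
  all_goals first | ring1 | linear_combination (4 / 9) * sqrt_two_mul_self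

lemma star_psiState (i j : Fin 2 × Fin 2 × Fin 2) : star (psiState i j) = psiState j i :=
  isState_psiState.1.1.apply j i

lemma isHermitian_partialTranspose_reduceAB :
    (partialTranspose (reduceAB psiState)).IsHermitian := by
  ext i j
  simp only [partialTranspose, reduceAB, Matrix.conjTranspose_apply, Matrix.of_apply, star_sum,
    star_psiState]

lemma isHermitian_partialTranspose_reduceAC :
    (partialTranspose (reduceAC psiState)).IsHermitian := by
  ext i j
  simp only [partialTranspose, reduceAC, Matrix.conjTranspose_apply, Matrix.of_apply, star_sum,
    star_psiState]

lemma trace_partialTranspose_reduceAB_mul_sign :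
    (partialTranspose (reduceAB psiState) * signAB).trace = ((3 / 2 : ℝ) : ℂ) := by
  simp only [Matrix.trace, Matrix.diag_apply, Matrix.mul_apply, Fintype.sum_prod_type,
    Fin.sum_univ_two, partialTranspose, reduceAB, Matrix.of_apply, psiState, Matrix.vecMulVec_apply,
    Pi.star_apply, psi_apply, signAB]
  simp
  linear_combination (7 / 12) * sqrt_two_mul_self

lemma trace_partialTranspose_reduceAC_mul_sign :
    (partialTranspose (reduceAC psiState) * signAC).trace = ((3 / 2 : ℝ) : ℂ) := by
  simp only [Matrix.trace, Matrix.diag_apply, Matrix.mul_apply, Fintype.sum_prod_type,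
    Fin.sum_univ_two, partialTranspose, reduceAC, Matrix.of_apply, psiState, Matrix.vecMulVec_apply,
    Pi.star_apply, psi_apply, signAC]
  simp
  linear_combination (7 / 12) * sqrt_two_mul_self

lemma logNegativity_psiState_lt {α : ℝ≥0∞} (hα : 1 ≤ α) :
    logNegativity α (Fin 2) (Fin 2 × Fin 2) psiState <
      logNegativity α (Fin 2) (Fin 2) (reduceAB psiState) +
        logNegativity α (Fin 2) (Fin 2) (reduceAC psiState) := by
  have hAB := le_logNegativity hα isHermitian_partialTranspose_reduceAB isHermitian_signAB
    signAB_mul_self (by norm_num) trace_partialTranspose_reduceAB_mul_sign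
  have hAC := le_logNegativity hα isHermitian_partialTranspose_reduceAC isHermitian_signAC
    signAC_mul_self (by norm_num) trace_partialTranspose_reduceAC_mul_sign
  have hBC := logNegativity_maxEntangled_le hα schmidtVec_orthonormal
  rw [← psi_eq_maxEntangled] at hBC
  refine hBC.trans_lt (lt_of_lt_of_le ?_ (add_le_add hAB hAC))
  -- What remains is 2 < (3/2)·(3/2) under the logarithm.
  rw [← EReal.coe_add, EReal.coe_lt_coe_iff, Fintype.card_fin, Nat.cast_ofNat, ← add_div,
    ← Real.log_mul (by norm_num) (by norm_num)]
  exact div_lt_div_of_pos_right (Real.log_lt_log (by norm_num) (by norm_num))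
    (Real.log_pos one_lt_two)

end ThreeQubit

end AlphaLogNeg

theorem mainTheorem11 :
    AlphaLogNeg.IsState AlphaLogNeg.psiState ∧
    ∀ α : ℝ≥0∞, 1 ≤ α →
      ¬ AlphaLogNeg.IsMonogamous (@AlphaLogNeg.logNegativity α) ∧
      AlphaLogNeg.logNegativity α (Fin 2) (Fin 2 × Fin 2) AlphaLogNeg.psiState <
        AlphaLogNeg.logNegativity α (Fin 2) (Fin 2) (AlphaLogNeg.reduceAB AlphaLogNeg.psiState) +
        AlphaLogNeg.logNegativity α (Fin 2) (Fin 2)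
          (AlphaLogNeg.reduceAC AlphaLogNeg.psiState) := by
  refine ⟨AlphaLogNeg.isState_psiState, fun α hα => ?_⟩
  have h := AlphaLogNeg.logNegativity_psiState_lt hα
  exact ⟨fun hM => absurd (hM (Fin 2) (Fin 2) (Fin 2) _ AlphaLogNeg.isState_psiState) h.not_ge, h⟩
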